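/- Let $K\subset\mathbb R^2$ be a nonempty compact connected set with $L:=\mathcal H^1(K)<+\infty$. Write $B(x,r)$ for the open Euclidean ball and $d_H$ for the Hausdorff distance. Call a line $T\subset\mathbb R^2$ through a point $x\in K$ a tangent line to $K$ at $x$ if $$\lim_{r\to0^+}\frac{d_H\big(K\cap B(x,r),\,T\cap B(x,r)\big)}{r}=0 .$$ Then: (i) There exists a Lipschitz surjective mapping $f:[0,L]\to K$. Moreover $K$ is arcwise connected: any two distinct points of $K$ are joined by an injective continuous path contained in $K$. (ii) For $\mathcal H^1$-a.e. $x\in K$ there exists a tangent line $T_x$ to $K$ at $x$. (iii) For every $x\in K$, every tangent line $T_x$ to $K$ at $x$ and every $\varepsilon\in(0,1/2)$ there exists $r_0>0$ such that $$\pi\big(K\cap B(x,r)\big)\supseteq T_x\cap B\big(x,(1-\varepsilon)r\big)\qquad\text{for all } 0<r\le r_0,$$ where $\pi:\mathbb R^2\to T_x$ is the orthogonal projection onto the line $T_x$. -/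

import Mathlib

open Set Filter Topology MeasureTheory
open scoped NNReal

/-- The Euclidean plane. -/
abbrev Plane : Type := EuclideanSpace ℝ (Fin 2)

/-- `K` is nonempty and any two distinct points of `K` are the endpoints of an arc (an injective
path) contained in `K`. -/
def IsArcwiseConnected (K : Set Plane) : Prop :=
  K.Nonempty ∧ ∀ x ∈ K, ∀ y ∈ K, x ≠ y →
    ∃ γ : Path x y, Function.Injective γ ∧ Set.range γ ⊆ K

/-- `T` is a line through `x`, and the Hausdorff distance between `K ∩ B(x,r)` and `T ∩ B(x,r)`
is `o(r)` as `r → 0⁺`.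

For `x ∈ K` both sets contain `x` and are bounded, so `Metric.hausdorffDist` is the true
(finite) Hausdorff distance. -/
def IsTangentLine (K : Set Plane) (x : Plane) (T : AffineSubspace ℝ Plane) : Prop :=
  x ∈ T ∧ Module.finrank ℝ T.direction = 1 ∧
    Tendsto (fun r : ℝ =>
        Metric.hausdorffDist (K ∩ Metric.ball x r) ((T : Set Plane) ∩ Metric.ball x r) / r)
      (𝓝[>] (0 : ℝ)) (𝓝 0)

/-!
The length enters through one density estimate: if `K` is connected and has a point at distance at
least `r` from `x ∈ K`, then `K ∩ B(x, r)` has length at least `r`, because `dist · x` is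
1-Lipschitz and maps it onto an interval containing `[0, r)`
(`ofReal_le_hausdorffMeasure_inter_ball`).

*Parametrization.* By the density estimate an `ε`-separated subset of `K` has at most `2 L / ε`
points. Starting from one point and repeatedly making a detour to a point of `K` at distance exactly
`ε` from the points visited so far gives a closed walk with steps of size `ε`, of length at most
`4 L`, that is `ε`-dense in `K` (`exists_dense_chain`). The walks, run at constant speed on `[0, 1]`,
have a Lipschitz limit along an ultrafilter as `ε → 0`, and this limit is onto
(`exists_lipschitz_parametrization`).

*Arcs.* Among the curves in `K` on `[0, 1]` joining two given points there is one with the least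
Lipschitz constant. It is injective, since cutting out a loop and rescaling would lower the constant
(`exists_injOn_lipschitz_curve`).

*Tangents.* Let `E ⊆ K` be closed. At almost every `x ∈ E`, points `y ∈ K` are within
`o(|y - x|)` of `E` as `y → x` (`hausdorffMeasure_porous_eq_zero`): otherwise, by the density
estimate, balls around the exceptional points contain a fixed proportion of length from `K \ E`, and
a Vitali covering bounds the length of the exceptional set by a multiple of the length of `K \ E` in
small neighbourhoods of `E`, which tends to zero. This is applied to the subarcs `E = f([p, q])` with
rational `p < q`. By Rademacher's theorem and a one-dimensional Sard theorem, almost every point of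
`K` is `f t` with `f' t ≠ 0`. Near such a point a short subarc around `t` is close to the line
through `f t` in the direction `f' t`, and `K` is close to the subarc
(`isTangentLine_of_hasDerivAt`).

*Projections.* Near `x` the set `K` lies in a narrow cone around the tangent line. If a point of the
tangent line close to `x` is not a projection of a point of `K` near `x`, the corresponding normal
line is a gap in `K`. Two gaps on the same side of `x`, at distances `s < s₀ / 4`, would cut off a
nonempty clopen part of `K` that does not contain `x`; so on each side there are no gaps at all below
some scale (`exists_forall_pos_exists_inner_eq`).
-/

/-! ### Lipschitz parametrization -/

section Parametrization

variable {X : Type*} [MetricSpace X]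

/-- The lower density estimate for continua: `dist · x` is 1-Lipschitz and maps `K ∩ B(x, r)` onto a
set containing `[0, r)`. -/
theorem ofReal_le_hausdorffMeasure_inter_ball [MeasurableSpace X] [BorelSpace X] {K : Set X}
    (hK : IsPreconnected K) {x y : X} (hx : x ∈ K) (hy : y ∈ K) {r : ℝ} (hr : r ≤ dist y x) :
    ENNReal.ofReal r ≤ Measure.hausdorffMeasure 1 (K ∩ Metric.ball x r) := by
  have hlip : LipschitzWith 1 (fun z : X => dist z x) := LipschitzWith.dist_left x
  have hsub : Ico 0 r ⊆ (fun z : X => dist z x) '' (K ∩ Metric.ball x r) := by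
    intro c hc
    obtain ⟨z, hz, hzc⟩ := hK.intermediate_value hx hy
      (f := fun z : X => dist z x) hlip.continuous.continuousOn
      (show c ∈ Icc (dist x x) (dist y x) from ⟨by simpa using hc.1, hc.2.le.trans hr⟩)
    exact ⟨z, ⟨hz, by simpa [Metric.mem_ball, hzc] using hc.2⟩, hzc⟩
  calc ENNReal.ofReal r = Measure.hausdorffMeasure 1 (Ico 0 r) := by
        rw [hausdorffMeasure_real, Real.volume_Ico, sub_zero]
    _ ≤ Measure.hausdorffMeasure 1 ((fun z : X => dist z x) '' (K ∩ Metric.ball x r)) :=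
        measure_mono hsub
    _ ≤ _ := by
        simpa using hlip.hausdorffMeasure_image_le zero_le_one (K ∩ Metric.ball x r)

theorem exists_half_dist_le (a b x : X) : dist a b / 2 ≤ dist a x ∨ dist a b / 2 ≤ dist b x := by
  by_contra! h
  have := dist_triangle_right a b x
  linarith [h.1, h.2]

/-- The balls of radius `ε / 2` around `ε`-separated points are disjoint, and each one carries
length at least `ε / 2`. -/
theorem card_mul_le_of_separated [MeasurableSpace X] [BorelSpace X] {K : Set X}
    (hKc : IsCompact K) (hK : IsPreconnected K) (hfin : Measure.hausdorffMeasure 1 K < ⊤)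
    {a b : X} (ha : a ∈ K) (hb : b ∈ K) {ε : ℝ} (hε : 0 < ε) (hεab : ε ≤ dist a b)
    {S : Finset X} (hS : ∀ p ∈ S, p ∈ K) (hsep : (S : Set X).Pairwise fun p q => ε ≤ dist p q) :
    S.card * (ε / 2) ≤ (Measure.hausdorffMeasure 1 K).toReal := by
  have hball : ∀ p ∈ S, ENNReal.ofReal (ε / 2) ≤
      Measure.hausdorffMeasure 1 (K ∩ Metric.ball p (ε / 2)) := by
    intro p hp
    rcases exists_half_dist_le a b p with h | h
    · exact ofReal_le_hausdorffMeasure_inter_ball hK (hS p hp) ha (by linarith)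
    · exact ofReal_le_hausdorffMeasure_inter_ball hK (hS p hp) hb (by linarith)
  have hdisj : (S : Set X).PairwiseDisjoint fun p => K ∩ Metric.ball p (ε / 2) := by
    intro p hp q hq hpq
    refine (Metric.ball_disjoint_ball ?_).mono inter_subset_right inter_subset_right
    linarith [hsep hp hq hpq]
  have hsum : (S.card : ENNReal) * ENNReal.ofReal (ε / 2) ≤ Measure.hausdorffMeasure 1 K := by
    calc (S.card : ENNReal) * ENNReal.ofReal (ε / 2) = ∑ _p ∈ S, ENNReal.ofReal (ε / 2) := by
          simp
      _ ≤ ∑ p ∈ S, Measure.hausdorffMeasure 1 (K ∩ Metric.ball p (ε / 2)) :=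
          Finset.sum_le_sum hball
      _ = Measure.hausdorffMeasure 1 (⋃ p ∈ S, K ∩ Metric.ball p (ε / 2)) :=
          (measure_biUnion_finset hdisj fun p _ =>
            hKc.measurableSet.inter Metric.isOpen_ball.measurableSet).symm
      _ ≤ _ := measure_mono (iUnion₂_subset fun p _ => inter_subset_left)
  have := ENNReal.toReal_mono hfin.ne hsum
  rwa [ENNReal.toReal_mul, ENNReal.toReal_natCast, ENNReal.toReal_ofReal (by positivity)] at this

/-- If the points of a chain do not come within `ε` of every point of the connected set `K`, some
point of `K` is at distance exactly `ε` from them; a detour to that point lengthens the chain by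
two. -/
theorem exists_chain_extension {K : Set X} (hK : IsPreconnected K) {ε : ℝ} (hε : 0 < ε)
    {l : List X} (hl : l ≠ []) (hlK : ∀ p ∈ l, p ∈ K) (hc : l.IsChain fun p q => dist p q ≤ ε)
    {y : X} (hy : y ∈ K) (hyl : ∀ p ∈ l, ε < dist y p) :
    ∃ z ∈ K, (∀ p ∈ l, ε ≤ dist z p) ∧ ∃ l' : List X, (∀ p, p ∈ l' ↔ p = z ∨ p ∈ l) ∧
      (l'.IsChain fun p q => dist p q ≤ ε) ∧ l'.length = l.length + 2 := by
  classical
  set S : Set X := {p | p ∈ l} with hS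
  have hSfin : S.Finite := l.finite_toSet
  obtain ⟨p₀, hp₀⟩ := List.exists_mem_of_ne_nil l hl
  have hSne : S.Nonempty := ⟨p₀, hp₀⟩
  have hyS : ε ≤ Metric.infDist y S := (Metric.le_infDist hSne).2 fun {p} hp => (hyl p hp).le
  obtain ⟨z, hz, hzS⟩ := hK.intermediate_value (hlK p₀ hp₀) hy
    (f := fun z => Metric.infDist z S) (Metric.continuous_infDist_pt S).continuousOn
    (show ε ∈ Icc _ _ from ⟨(Metric.infDist_zero_of_mem (s := S) hp₀).trans_le hε.le, hyS⟩)
  obtain ⟨u, hu, huz⟩ := hSfin.isCompact.exists_infDist_eq_dist hSne z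
  have hzu : dist z u = ε := by rw [← huz]; exact hzS
  refine ⟨z, hz, fun p hp => hzS ▸ Metric.infDist_le_dist_of_mem hp, ?_⟩
  obtain ⟨l₁, l₂, rfl⟩ := List.append_of_mem (show u ∈ l from hu)
  obtain ⟨hc₁, hc₂⟩ := List.isChain_split.1 hc
  refine ⟨l₁ ++ u :: z :: u :: l₂, fun p => ?_, ?_, by simp; omega⟩
  · simp only [List.mem_append, List.mem_cons]
    tauto
  · rw [List.isChain_split, List.isChain_cons_cons, List.isChain_cons_cons]
    exact ⟨hc₁, by rw [dist_comm]; exact hzu.le, hzu.le, hc₂⟩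

/-- A discrete closed-walk approximation of `K`: a chain with steps at most `ε`, of total length
controlled by `4 * μH[1] K`, that is `ε`-dense in `K`. -/
theorem exists_dense_chain [MeasurableSpace X] [BorelSpace X] {K : Set X}
    (hKc : IsCompact K) (hK : IsPreconnected K) (hfin : Measure.hausdorffMeasure 1 K < ⊤)
    {a b : X} (ha : a ∈ K) (hb : b ∈ K) {ε : ℝ} (hε : 0 < ε) (hεab : ε ≤ dist a b) :
    ∃ l : List X, l ≠ [] ∧ (∀ p ∈ l, p ∈ K) ∧ (l.IsChain fun p q => dist p q ≤ ε) ∧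
      l.length * ε ≤ 4 * (Measure.hausdorffMeasure 1 K).toReal ∧
      ∀ y ∈ K, ∃ p ∈ l, dist y p ≤ ε := by
  classical
  set L := (Measure.hausdorffMeasure 1 K).toReal with hL
  by_contra! hcon
  -- Without a dense chain, chains visiting arbitrarily many `ε`-separated points could be built.
  have key : ∀ n : ℕ, ∃ (l : List X) (S : Finset X), l ≠ [] ∧ (∀ p, p ∈ S ↔ p ∈ l) ∧
      (∀ p ∈ l, p ∈ K) ∧ (l.IsChain fun p q => dist p q ≤ ε) ∧
      ((S : Set X).Pairwise fun p q => ε ≤ dist p q) ∧ S.card = n + 1 ∧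
      l.length ≤ 2 * S.card := by
    intro n
    induction n with
    | zero => exact ⟨[a], {a}, by simp, by simp, by simpa using ha, by simp, by simp, by simp,
        by simp⟩
    | succ n ih =>
      obtain ⟨l, S, hl, hSl, hlK, hc, hsep, hcard, hlen⟩ := ih
      have hbound := card_mul_le_of_separated hKc hK hfin ha hb hε hεab
        (fun p hp => hlK p ((hSl p).1 hp)) hsep
      have hlen' : l.length * ε ≤ 4 * L := by
        have : (l.length : ℝ) ≤ 2 * S.card := by exact_mod_cast hlen
        nlinarith
      obtain ⟨y, hy, hyl⟩ := hcon l hl hlK hc hlen'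
      obtain ⟨z, hz, hzl, l', hl', hc', hlen''⟩ := exists_chain_extension hK hε hl hlK hc hy hyl
      have hzS : z ∉ S := fun h => by
        have := hzl z ((hSl z).1 h)
        rw [dist_self] at this
        linarith
      refine ⟨l', insert z S, ?_, fun p => ?_, fun p hp => ?_, hc', ?_, ?_, ?_⟩
      · exact List.ne_nil_of_mem ((hl' z).2 (Or.inl rfl))
      · rw [Finset.mem_insert, hl', hSl]
      · rcases (hl' p).1 hp with rfl | hp
        exacts [hz, hlK p hp]
      · rw [Finset.coe_insert]
        refine hsep.insert fun p hp _ => ⟨hzl p ((hSl p).1 hp), ?_⟩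
        rw [dist_comm]
        exact hzl p ((hSl p).1 hp)
      · rw [Finset.card_insert_of_notMem hzS, hcard]
      · rw [Finset.card_insert_of_notMem hzS, hlen'']
        omega
  obtain ⟨n, hn⟩ := exists_nat_gt (L / (ε / 2))
  obtain ⟨l, S, hl, hSl, hlK, hc, hsep, hcard, hlen⟩ := key n
  have hbound := card_mul_le_of_separated hKc hK hfin ha hb hε hεab
    (fun p hp => hlK p ((hSl p).1 hp)) hsep
  rw [div_lt_iff₀ (by positivity)] at hn
  rw [hcard] at hbound
  push_cast at hbound
  nlinarith

/-- Traversing a dense chain at constant speed gives a step function that is Lipschitz up to an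
error `ε`. -/
theorem exists_approx_parametrization [MeasurableSpace X] [BorelSpace X] {K : Set X}
    (hKc : IsCompact K) (hK : IsPreconnected K) (hfin : Measure.hausdorffMeasure 1 K < ⊤)
    {a b : X} (ha : a ∈ K) (hb : b ∈ K) {ε : ℝ} (hε : 0 < ε) (hεab : ε ≤ dist a b) :
    ∃ F : ℝ → X, (∀ t, F t ∈ K) ∧
      (∀ s t, dist (F s) (F t) ≤
        4 * (Measure.hausdorffMeasure 1 K).toReal * dist s t + ε) ∧
      ∀ y ∈ K, ∃ t ∈ Icc (0 : ℝ) 1, dist y (F t) ≤ ε := by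
  obtain ⟨l, hl, hlK, hc, hlen, hdense⟩ := exists_dense_chain hKc hK hfin ha hb hε hεab
  set L := (Measure.hausdorffMeasure 1 K).toReal with hL
  have hpos : 0 < l.length := List.length_pos_of_ne_nil hl
  have hM : (0 : ℝ) < l.length := by exact_mod_cast hpos
  -- Past its last point the chain is continued by a constant.
  let g : ℕ → X := fun i => l[min i (l.length - 1)]
  have hgK : ∀ i, g i ∈ K := fun i => hlK _ (List.getElem_mem _)
  have hstep : ∀ i, dist (g i) (g (i + 1)) ≤ ε := by
    intro i
    by_cases hi : i + 1 < l.length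
    · have h1 : min i (l.length - 1) = i := by omega
      have h2 : min (i + 1) (l.length - 1) = i + 1 := by omega
      simp only [g, h1, h2]
      exact List.isChain_iff_getElem.1 hc i hi
    · have h1 : min i (l.length - 1) = min (i + 1) (l.length - 1) := by omega
      simp only [g, h1, dist_self]
      exact hε.le
  have hg : ∀ m n : ℕ, m ≤ n → dist (g m) (g n) ≤ (n - m : ℝ) * ε := by
    intro m n hmn
    have := dist_le_Ico_sum_of_dist_le (f := g) hmn (d := fun _ => ε) (fun {k} _ _ => hstep k)
    simpa [Nat.cast_sub hmn] using this
  have hF : ∀ s t : ℝ, s ≤ t →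
      dist (g ⌊s * l.length⌋₊) (g ⌊t * l.length⌋₊) ≤ 4 * L * (t - s) + ε := by
    intro s t hst
    have hst' : s * l.length ≤ t * l.length := by gcongr
    refine (hg _ _ (Nat.floor_mono hst')).trans ?_
    have hfl : (⌊t * l.length⌋₊ : ℝ) - ⌊s * l.length⌋₊ ≤ (t - s) * l.length + 1 := by
      rcases le_or_gt 0 (t * l.length) with ht | ht
      · have h1 := Nat.floor_le ht
        have h2 := Nat.lt_floor_add_one (s * l.length)
        linarith
      · rw [Nat.floor_of_nonpos ht.le, Nat.floor_of_nonpos (hst'.trans ht.le)]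
        nlinarith
    nlinarith [mul_le_mul_of_nonneg_right hfl hε.le,
      mul_le_mul_of_nonneg_left hlen (sub_nonneg.2 hst)]
  refine ⟨fun t => g ⌊t * l.length⌋₊, fun t => hgK _, fun s t => ?_, fun y hy => ?_⟩
  · rcases le_total s t with h | h
    · rw [dist_comm s t, Real.dist_eq, abs_of_nonneg (sub_nonneg.2 h)]
      exact hF s t h
    · rw [dist_comm, Real.dist_eq, abs_of_nonneg (sub_nonneg.2 h)]
      exact hF t s h
  · obtain ⟨p, hp, hyp⟩ := hdense y hy
    obtain ⟨i, hi, rfl⟩ := List.getElem_of_mem hp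
    refine ⟨i / l.length, ⟨by positivity, ?_⟩, ?_⟩
    · rw [div_le_one hM]
      exact_mod_cast hi.le
    · have h1 : min i (l.length - 1) = i := by omega
      have h2 : ⌊(i / l.length : ℝ) * l.length⌋₊ = i := by
        rw [div_mul_cancel₀ _ hM.ne', Nat.floor_natCast]
      simpa only [h2, g, h1] using hyp

/-- Pointwise limits along an ultrafilter of asymptotically Lipschitz maps into a compact set: a
substitute for the Arzelà–Ascoli theorem that needs no subsequences and no continuity of the
approximating maps. -/
theorem exists_lipschitz_limit {K : Set X} (hK : IsCompact K) {F : ℕ → ℝ → X} {C : ℝ}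
    {c e : ℕ → ℝ} (hc : Tendsto c atTop (𝓝 C)) (he : Tendsto e atTop (𝓝 0))
    (hF : ∀ n t, F n t ∈ K) (hd : ∀ n s t, dist (F n s) (F n t) ≤ c n * dist s t + e n) :
    ∃ (f : ℝ → X) (U : Ultrafilter ℕ), ↑U ≤ (atTop : Filter ℕ) ∧ (∀ t, f t ∈ K) ∧
      (∀ s t, dist (f s) (f t) ≤ C * dist s t) ∧
      ∀ t, Tendsto (fun n => F n t) U (𝓝 (f t)) := by
  let U : Ultrafilter ℕ := hyperfilter ℕ
  have hU : ↑U ≤ (atTop : Filter ℕ) := Nat.hyperfilter_le_atTop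
  have hlim : ∀ t, ∃ x ∈ K, Tendsto (fun n => F n t) U (𝓝 x) := fun t =>
    hK.ultrafilter_le_nhds (U.map fun n => F n t)
      (le_principal_iff.2 (Filter.mem_map.2 (univ_mem' fun n => hF n t)))
  choose f hfK hf using hlim
  refine ⟨f, U, hU, hfK, fun s t => ?_, hf⟩
  have h1 : Tendsto (fun n => c n * dist s t + e n) U (𝓝 (C * dist s t + 0)) :=
    (((hc.mono_left hU).mul_const _).add (he.mono_left hU))
  rw [add_zero] at h1
  exact le_of_tendsto_of_tendsto' ((hf s).dist (hf t)) h1 fun n => hd n s t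

/-- A continuum of finite length is a Lipschitz image of the unit interval. -/
theorem exists_lipschitz_parametrization [MeasurableSpace X] [BorelSpace X] {K : Set X}
    (hKc : IsCompact K) (hK : IsPreconnected K) (hfin : Measure.hausdorffMeasure 1 K < ⊤)
    (hnt : K.Nontrivial) :
    ∃ (f : ℝ → X) (C : ℝ≥0), LipschitzWith C f ∧ (∀ t, f t ∈ K) ∧ f '' Icc 0 1 = K := by
  obtain ⟨a, ha, b, hb, hab⟩ := hnt
  set L := (Measure.hausdorffMeasure 1 K).toReal with hL
  have hd : 0 < dist a b := dist_pos.2 hab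
  let e : ℕ → ℝ := fun n => dist a b * (1 / ((n : ℝ) + 1))
  have he0 : ∀ n, 0 < e n := fun n => by positivity
  have he1 : ∀ n, e n ≤ dist a b := fun n => by
    refine mul_le_of_le_one_right hd.le ?_
    rw [div_le_one (by positivity)]
    linarith [(Nat.cast_nonneg n : (0 : ℝ) ≤ n)]
  have he : Tendsto e atTop (𝓝 0) := by
    simpa [e] using tendsto_one_div_add_atTop_nhds_zero_nat.const_mul (dist a b)
  choose F hFK hFd hFs using fun n =>
    exists_approx_parametrization hKc hK hfin ha hb (he0 n) (he1 n)
  obtain ⟨f, U, hU, hfK, hfd, hf⟩ :=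
    exists_lipschitz_limit hKc (tendsto_const_nhds (x := 4 * L)) he hFK hFd
  refine ⟨f, (4 * L).toNNReal, LipschitzWith.of_dist_le_mul fun s t => ?_, hfK,
    Subset.antisymm (image_subset_iff.2 fun t _ => hfK t) fun y hy => ?_⟩
  · rw [Real.coe_toNNReal _ (by positivity)]
    exact hfd s t
  · choose t ht hyt using fun n => hFs n y hy
    obtain ⟨t₀, ht₀, hlim⟩ := (isCompact_Icc (a := (0 : ℝ)) (b := 1)).ultrafilter_le_nhds
      (U.map t) (le_principal_iff.2 (Filter.mem_map.2 (univ_mem' ht)))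
    have hlim : Tendsto t U (𝓝 t₀) := hlim
    refine ⟨t₀, ht₀, ?_⟩
    have hbound : ∀ n, dist y (F n t₀) ≤ 4 * L * dist (t n) t₀ + (e n + e n) := fun n => by
      linarith [dist_triangle y (F n (t n)) (F n t₀), hyt n, hFd n (t n) t₀]
    have hright : Tendsto (fun n => 4 * L * dist (t n) t₀ + (e n + e n)) U (𝓝 0) := by
      have h1 := (hlim.dist (tendsto_const_nhds (x := t₀))).const_mul (4 * L)
      have h2 := (he.mono_left hU).add (he.mono_left hU)
      simpa using h1.add h2
    have := le_of_tendsto_of_tendsto' ((tendsto_const_nhds (x := y)).dist (hf t₀)) hright hbound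
    exact (dist_le_zero.1 this).symm

end Parametrization

/-! ### Arcs -/

section Arcs

variable {X : Type*} [MetricSpace X]

/-- Cutting out the loop of `g` between the parameters `s` and `t` and rescaling lowers the
Lipschitz constant by the factor `1 - (t - s)`. -/
theorem exists_lipschitz_cut_loop {K : Set X} {g : ℝ → X} {C : ℝ}
    (hgK : ∀ t, g t ∈ K) (hg : ∀ s t, dist (g s) (g t) ≤ C * dist s t) {s t : ℝ} (hs : 0 ≤ s)
    (hst : s < t) (ht : t ≤ 1) (heq : g s = g t) :
    ∃ h : ℝ → X, (∀ u, h u ∈ K) ∧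
      (∀ u w, dist (h u) (h w) ≤ C * (1 - (t - s)) * dist u w) ∧ h 0 = g 0 ∧ h 1 = g 1 := by
  classical
  let k : ℝ → X := fun w => if w ≤ s then g w else g (w + (t - s))
  have hk : ∀ u w, u ≤ w → dist (k u) (k w) ≤ C * (w - u) := by
    intro u w huw
    have hg' : ∀ p q, p ≤ q → dist (g p) (g q) ≤ C * (q - p) := fun p q hpq => by
      have := hg p q
      rwa [dist_comm p q, Real.dist_eq, abs_of_nonneg (sub_nonneg.2 hpq)] at this
    by_cases hw : w ≤ s
    · simp only [k, if_pos hw, if_pos (huw.trans hw)]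
      exact hg' u w huw
    · by_cases hu : u ≤ s
      · simp only [k, if_neg hw, if_pos hu]
        have h1 := hg' u s hu
        have h2 := hg' t (w + (t - s)) (by linarith)
        rw [← heq] at h2
        linarith [dist_triangle (g u) (g s) (g (w + (t - s)))]
      · simp only [k, if_neg hw, if_neg hu]
        have := hg' (u + (t - s)) (w + (t - s)) (by linarith)
        linarith
  have hle : 0 ≤ 1 - (t - s) := by linarith
  have hk' : ∀ u w : ℝ, u ≤ w → dist (k (u * (1 - (t - s)))) (k (w * (1 - (t - s)))) ≤
      C * (1 - (t - s)) * (w - u) := fun u w huw => by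
    have := hk _ _ (mul_le_mul_of_nonneg_right huw hle)
    linarith
  refine ⟨fun u => k (u * (1 - (t - s))), fun u => ?_, fun u w => ?_, ?_, ?_⟩
  · simp only [k]
    split_ifs <;> exact hgK _
  · rcases le_total u w with h | h
    · rw [dist_comm u w, Real.dist_eq, abs_of_nonneg (sub_nonneg.2 h)]
      exact hk' u w h
    · rw [dist_comm, Real.dist_eq, abs_of_nonneg (sub_nonneg.2 h)]
      exact hk' w u h
  · simp [k, hs]
  · by_cases h : 1 - (t - s) ≤ s
    · -- Here `t = 1`, so the loop that is cut out ends at the endpoint of the curve.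
      have ht1 : t = 1 := by linarith
      subst ht1
      have hs' : 1 * (1 - (1 - s)) = s := by ring
      simp only [k, hs', le_refl, if_true, heq]
    · simp [k, h]

/-- Two points of a compact set that are joined in it by a Lipschitz curve are joined by an
injective one: a curve of least Lipschitz constant has no loops. -/
theorem exists_injOn_lipschitz_curve {K : Set X} (hK : IsCompact K) {g₀ : ℝ → X} {C₀ : ℝ}
    (hg₀K : ∀ t, g₀ t ∈ K) (hg₀ : ∀ s t, dist (g₀ s) (g₀ t) ≤ C₀ * dist s t)
    (hne : g₀ 0 ≠ g₀ 1) :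
    ∃ (g : ℝ → X) (C : ℝ), (∀ t, g t ∈ K) ∧ (∀ s t, dist (g s) (g t) ≤ C * dist s t) ∧
      g 0 = g₀ 0 ∧ g 1 = g₀ 1 ∧ InjOn g (Icc 0 1) := by
  let A : Set ℝ := {C | ∃ g : ℝ → X, (∀ t, g t ∈ K) ∧
    (∀ s t, dist (g s) (g t) ≤ C * dist s t) ∧ g 0 = g₀ 0 ∧ g 1 = g₀ 1}
  have hA : A.Nonempty := ⟨C₀, g₀, hg₀K, hg₀, rfl, rfl⟩
  have hAbd : ∀ C ∈ A, dist (g₀ 0) (g₀ 1) ≤ C := by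
    rintro C ⟨g, -, hg, h0, h1⟩
    simpa [h0, h1] using hg 0 1
  obtain ⟨c, -, hc, hcA⟩ := exists_seq_tendsto_sInf hA ⟨_, hAbd⟩
  choose F hFK hFd hF0 hF1 using hcA
  obtain ⟨g, U, hU, hgK, hg, hlim⟩ := exists_lipschitz_limit hK hc
    (tendsto_const_nhds (x := (0 : ℝ))) hFK (fun n s t => by simpa using hFd n s t)
  have h0 : g 0 = g₀ 0 := tendsto_nhds_unique (hlim 0) (by simp [hF0])
  have h1 : g 1 = g₀ 1 := tendsto_nhds_unique (hlim 1) (by simp [hF1])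
  have hpos : 0 < sInf A := (dist_pos.2 hne).trans_le (le_csInf hA hAbd)
  have hlt : ∀ s t : ℝ, 0 ≤ s → s < t → t ≤ 1 → g s ≠ g t := by
    intro s t hs hst ht heq
    obtain ⟨h, hhK, hh, hh0, hh1⟩ := exists_lipschitz_cut_loop hgK hg hs hst ht heq
    have : sInf A ≤ sInf A * (1 - (t - s)) :=
      csInf_le ⟨_, hAbd⟩ ⟨h, hhK, hh, hh0.trans h0, hh1.trans h1⟩
    nlinarith
  refine ⟨g, sInf A, hgK, hg, h0, h1, fun s hs t ht heq => ?_⟩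
  rcases lt_trichotomy s t with h | h | h
  · exact absurd heq (hlt s t hs.1 h ht.2)
  · exact h
  · exact absurd heq.symm (hlt t s ht.1 h hs.2)

/-- Any two distinct points of a compact Lipschitz image of an interval are joined in it by an
arc. -/
theorem exists_injective_path {K : Set X} (hK : IsCompact K) {f : ℝ → X} {C : ℝ≥0}
    (hf : LipschitzWith C f) (hfK : ∀ t, f t ∈ K) (hfs : f '' Icc 0 1 = K) {x y : X} (hx : x ∈ K)
    (hy : y ∈ K) (hxy : x ≠ y) :
    ∃ γ : Path x y, Function.Injective γ ∧ range γ ⊆ K := by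
  rw [← hfs] at hx hy
  obtain ⟨a, -, rfl⟩ := hx
  obtain ⟨b, -, rfl⟩ := hy
  obtain ⟨g, C', hgK, hg, h0, h1, hinj⟩ := exists_injOn_lipschitz_curve hK
    (g₀ := fun t => f (a + t * (b - a))) (C₀ := C * |b - a|) (fun t => hfK _)
    (fun s t => by
      refine (hf.dist_le_mul _ _).trans_eq ?_
      rw [Real.dist_eq, Real.dist_eq, show a + s * (b - a) - (a + t * (b - a)) =
        (b - a) * (s - t) by ring, abs_mul, mul_assoc])
    (by simpa using hxy)
  have hcont : Continuous g := by
    refine (LipschitzWith.of_dist_le_mul (K := C'.toNNReal) fun s t => (hg s t).trans ?_).continuous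
    gcongr
    exact Real.le_coe_toNNReal C'
  refine ⟨⟨⟨fun t : unitInterval => g t, hcont.comp continuous_subtype_val⟩, ?_, ?_⟩, ?_, ?_⟩
  · simpa using h0
  · simpa using h1
  · exact fun s t hst => Subtype.ext (hinj s.2 t.2 hst)
  · rintro _ ⟨t, rfl⟩
    exact hgK t

end Arcs

/-! ### Porosity -/

section Porosity

variable {X : Type*} [MetricSpace X] [MeasurableSpace X] [BorelSpace X]

/-- At a point where `K` leaves `E` porously at a small scale `r`, the set `K \ E` has length at
least `ε * r` in a ball of radius `2 * r`; a Vitali family of such balls has total radius bounded by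
the length of `K \ E` near `E`. -/
theorem exists_porous_cover [TopologicalSpace.SeparableSpace X] {K : Set X} (hKc : IsCompact K)
    (hK : IsPreconnected K) {a b : X} (ha : a ∈ K) (hb : b ∈ K) {E : Set X}
    {ε : ℝ} (hε : 0 < ε) (hε1 : ε ≤ 1) {δ : ℝ} (hδ : 0 < δ)
    (hδab : δ ≤ dist a b / 2) :
    ∃ (u : Set (X × X)) (B : u → Set X), u.Countable ∧
      {x ∈ E | ∀ ρ > 0, ∃ y ∈ K, dist y x < ρ ∧ ε * dist y x < Metric.infDist y E} ⊆ ⋃ i, B i ∧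
      (∀ i, Metric.ediam (B i) ≤ ENNReal.ofReal (20 * δ)) ∧
      ∑' i, Metric.ediam (B i) ≤ ENNReal.ofReal (20 / ε) *
        (Measure.hausdorffMeasure 1).restrict K (Metric.cthickening (2 * δ) E \ E) := by
  let r : X × X → ℝ := fun p => dist p.2 p.1
  let t : Set (X × X) := {p | p.1 ∈ E ∧ p.2 ∈ K ∧ r p < δ ∧ ε * r p < Metric.infDist p.2 E}
  have hrpos : ∀ p ∈ t, 0 < r p := by
    rintro ⟨x, y⟩ ⟨hx, hy, -, hlt⟩
    refine dist_pos.2 fun h => ?_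
    have h : y = x := h
    subst h
    simp [r, Metric.infDist_zero_of_mem hx] at hlt
  obtain ⟨u, hut, hdisj, hcov⟩ :=
    Vitali.exists_disjoint_subfamily_covering_enlargement_closedBall t Prod.fst
      (fun p => 2 * r p) (2 * δ) (fun p hp => by linarith [hp.2.2.1]) 5 (by norm_num)
  have hu : u.Countable := by
    refine hdisj.countable_of_nonempty_interior fun p hp => ?_
    refine ⟨p.1, interior_mono Metric.ball_subset_closedBall ?_⟩
    rw [Metric.isOpen_ball.interior_eq]
    exact Metric.mem_ball_self (by linarith [hrpos p (hut hp)])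
  have := hu.to_subtype
  have hdiam : ∀ p ∈ u, Metric.ediam (Metric.closedBall p.1 (5 * (2 * r p))) ≤
      ENNReal.ofReal (20 * r p) := by
    intro p hp
    refine Metric.ediam_le_of_forall_dist_le fun y hy z hz => ?_
    have := dist_triangle_right y z p.1
    rw [Metric.mem_closedBall] at hy hz
    linarith
  -- The part of `K` near `y` that is missed by `E`; the Vitali balls make these parts disjoint.
  let V : X × X → Set X := fun p => K ∩ Metric.ball p.2 (ε * r p)
  have hVball : ∀ p ∈ u, V p ⊆ Metric.closedBall p.1 (2 * r p) := by
    rintro p hp z ⟨-, hz⟩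
    have h1 := hrpos p (hut hp)
    have h2 : ε * r p ≤ r p := mul_le_of_le_one_left h1.le hε1
    rw [Metric.mem_ball] at hz
    rw [Metric.mem_closedBall]
    have h3 : dist p.2 p.1 = r p := rfl
    linarith [dist_triangle z p.2 p.1]
  have hVE : ∀ p ∈ u, V p ⊆ Metric.cthickening (2 * δ) E \ E := by
    intro p hp z hz
    obtain ⟨hpE, -, hpδ, hlt⟩ := hut hp
    refine ⟨Metric.mem_cthickening_of_dist_le z p.1 _ _ hpE ?_, fun hzE => ?_⟩
    · have := hVball p hp hz
      rw [Metric.mem_closedBall] at this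
      linarith
    · have h1 := Metric.infDist_le_dist_of_mem (x := p.2) hzE
      have h2 : dist z p.2 < ε * r p := hz.2
      rw [dist_comm] at h2
      linarith
  have hVmeas : ∀ p ∈ u, ENNReal.ofReal (ε * r p) ≤
      (Measure.hausdorffMeasure 1).restrict K (V p) := by
    intro p hp
    obtain ⟨-, hpK, hpδ, -⟩ := hut hp
    have h1 := hrpos p (hut hp)
    have h2 : ε * r p ≤ r p := mul_le_of_le_one_left h1.le hε1
    rw [Measure.restrict_apply' hKc.measurableSet, inter_eq_left.2 inter_subset_left]
    rcases exists_half_dist_le a b p.2 with h | h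
    · exact ofReal_le_hausdorffMeasure_inter_ball hK hpK ha (by linarith)
    · exact ofReal_le_hausdorffMeasure_inter_ball hK hpK hb (by linarith)
  refine ⟨u, fun p => Metric.closedBall p.1.1 (5 * (2 * r p.1)), hu, ?_, ?_, ?_⟩
  · rintro x ⟨hxE, hx⟩
    obtain ⟨y, hyK, hyδ, hlt⟩ := hx δ hδ
    have hxt : (x, y) ∈ t := ⟨hxE, hyK, hyδ, hlt⟩
    obtain ⟨p, hp, hsub⟩ := hcov (x, y) hxt
    exact mem_iUnion.2 ⟨⟨p, hp⟩, hsub (Metric.mem_closedBall_self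
      (by linarith [hrpos _ hxt]))⟩
  · rintro ⟨p, hp⟩
    exact (hdiam p hp).trans (ENNReal.ofReal_le_ofReal (by linarith [(hut hp).2.2.1]))
  · calc ∑' p : u, Metric.ediam (Metric.closedBall p.1.1 (5 * (2 * r p.1)))
        ≤ ∑' p : u, ENNReal.ofReal (20 / ε) * (Measure.hausdorffMeasure 1).restrict K (V p.1) := by
          refine ENNReal.tsum_le_tsum fun p => (hdiam p.1 p.2).trans ?_
          calc ENNReal.ofReal (20 * r p.1)
              = ENNReal.ofReal (20 / ε) * ENNReal.ofReal (ε * r p.1) := by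
                rw [← ENNReal.ofReal_mul (by positivity)]
                congr 1
                field_simp
            _ ≤ _ := by gcongr; exact hVmeas p.1 p.2
      _ = ENNReal.ofReal (20 / ε) *
            ∑' p : u, (Measure.hausdorffMeasure 1).restrict K (V p.1) := ENNReal.tsum_mul_left
      _ ≤ ENNReal.ofReal (20 / ε) *
            (Measure.hausdorffMeasure 1).restrict K (⋃ p : u, V p.1) := by
          gcongr
          refine tsum_meas_le_meas_iUnion_of_disjoint _
            (fun p => hKc.measurableSet.inter Metric.isOpen_ball.measurableSet) fun p q hpq => ?_
          exact (hdisj p.2 q.2 fun h => hpq (Subtype.ext h)).mono (hVball p.1 p.2)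
            (hVball q.1 q.2)
      _ ≤ _ := by
          gcongr
          exact iUnion_subset fun p => hVE p.1 p.2

/-- A closed subset `E` of a continuum `K` of finite length is almost nowhere porous in `K`: at
almost every point `x` of `E`, nearby points `y` of `K` are within `o(dist y x)` of `E`. -/
theorem hausdorffMeasure_porous_eq_zero [TopologicalSpace.SeparableSpace X] {K : Set X}
    (hKc : IsCompact K) (hK : IsPreconnected K) (hfin : Measure.hausdorffMeasure 1 K < ⊤)
    (hnt : K.Nontrivial) {E : Set X} (hE : IsClosed E) {ε : ℝ} (hε : 0 < ε)
    (hε1 : ε ≤ 1) :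
    Measure.hausdorffMeasure 1
      {x ∈ E | ∀ ρ > 0, ∃ y ∈ K, dist y x < ρ ∧ ε * dist y x < Metric.infDist y E} = 0 := by
  obtain ⟨a, ha, b, hb, hab⟩ := hnt
  have hd : 0 < dist a b := dist_pos.2 hab
  let μ : Measure X := (Measure.hausdorffMeasure 1).restrict K
  have : IsFiniteMeasure μ := ⟨by simpa [μ] using hfin⟩
  let δ : ℕ → ℝ := fun n => dist a b / 2 * (1 / ((n : ℝ) + 1))
  have hδ0 : ∀ n, 0 < δ n := fun n => by positivity
  have hδ1 : ∀ n, δ n ≤ dist a b / 2 := fun n => by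
    refine mul_le_of_le_one_right (by positivity) ?_
    rw [div_le_one (by positivity)]
    linarith [(Nat.cast_nonneg n : (0 : ℝ) ≤ n)]
  have hδ : Tendsto δ atTop (𝓝 0) := by
    simpa [δ] using tendsto_one_div_add_atTop_nhds_zero_nat.const_mul (dist a b / 2)
  choose u B hu hcov hdiam hsum using fun n =>
    exists_porous_cover hKc hK ha hb hε hε1 (hδ0 n) (hδ1 n)
  have : ∀ n, Countable (u n) := fun n => (hu n).to_subtype
  have hle := Measure.hausdorffMeasure_le_liminf_tsum 1
    {x ∈ E | ∀ ρ > 0, ∃ y ∈ K, dist y x < ρ ∧ ε * dist y x < Metric.infDist y E}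
    (l := atTop) (fun n => ENNReal.ofReal (20 * δ n))
    (by simpa using ENNReal.tendsto_ofReal (hδ.const_mul 20)) B
    (Eventually.of_forall hdiam) (Eventually.of_forall hcov)
  have hcth : Tendsto (fun n => μ (Metric.cthickening (2 * δ n) E)) atTop (𝓝 (μ E)) :=
    (tendsto_measure_cthickening_of_isClosed ⟨1, one_pos, measure_ne_top μ _⟩ hE).comp
      (by simpa using hδ.const_mul 2)
  have hdiff : Tendsto (fun n => μ (Metric.cthickening (2 * δ n) E \ E)) atTop (𝓝 0) := by
    have h := ENNReal.Tendsto.sub hcth (tendsto_const_nhds (x := μ E))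
      (Or.inl (measure_ne_top μ E))
    rw [tsub_self] at h
    refine h.congr fun n => ?_
    rw [measure_sdiff (Metric.self_subset_cthickening E) hE.measurableSet.nullMeasurableSet
      (measure_ne_top μ E)]
  have hlim : Tendsto (fun n => ENNReal.ofReal (20 / ε) *
      μ (Metric.cthickening (2 * δ n) E \ E)) atTop (𝓝 0) := by
    simpa using ENNReal.Tendsto.const_mul hdiff (Or.inr ENNReal.ofReal_ne_top)
  refine le_antisymm (hle.trans ?_) zero_le
  rw [← hlim.liminf_eq]
  exact liminf_le_liminf (Eventually.of_forall fun n => by simpa using hsum n)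

end Porosity

/-! ### Critical values of Lipschitz curves -/

section Derivative

/-- On the set of parameters where `f` is `η`-Lipschitz at scale `1 / k`, the image of each interval
of length `1 / k` has length at most `η / k`. -/
theorem hausdorffMeasure_image_le_of_small_scale {Y : Type*} [MetricSpace Y] [MeasurableSpace Y]
    [BorelSpace Y] {f : ℝ → Y} {η : ℝ≥0} {k : ℕ} (hk : 0 < k) :
    Measure.hausdorffMeasure 1
      (f '' {t ∈ Icc (0 : ℝ) 1 | ∀ s, |s - t| < 1 / k → dist (f s) (f t) ≤ η * |s - t|}) ≤
      2 * η := by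
  set Z := {t ∈ Icc (0 : ℝ) 1 | ∀ s, |s - t| < 1 / k → dist (f s) (f t) ≤ η * |s - t|} with hZ
  have hk' : (0 : ℝ) < k := by exact_mod_cast hk
  let I : ℕ → Set ℝ := fun j => Ico (j / k : ℝ) ((j + 1) / k)
  have hsub : f '' Z ⊆ ⋃ j ∈ Finset.range (k + 1), f '' (Z ∩ I j) := by
    rintro _ ⟨t, ht, rfl⟩
    have h0 : 0 ≤ t * k := mul_nonneg ht.1.1 hk'.le
    refine mem_iUnion₂.2 ⟨⌊t * k⌋₊, Finset.mem_range.2 ?_, t, ⟨ht, ?_, ?_⟩, rfl⟩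
    · have h1 : ⌊t * k⌋₊ ≤ k := by
        refine Nat.floor_le_of_le ?_
        nlinarith [ht.1.2]
      omega
    · rw [div_le_iff₀ hk']
      exact Nat.floor_le h0
    · rw [lt_div_iff₀ hk']
      exact Nat.lt_floor_add_one _
  have hpiece : ∀ j, Measure.hausdorffMeasure 1 (f '' (Z ∩ I j)) ≤ η * ENNReal.ofReal (1 / k) := by
    intro j
    have hlip : LipschitzOnWith η f (Z ∩ I j) := by
      refine LipschitzOnWith.of_dist_le_mul fun s hs t ht => ht.1.2 s ?_
      have h1 : ((j : ℝ) + 1) / k = j / k + 1 / k := add_div _ _ _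
      rw [abs_lt]
      constructor <;> linarith [hs.2.1, hs.2.2, ht.2.1, ht.2.2]
    calc Measure.hausdorffMeasure 1 (f '' (Z ∩ I j))
        ≤ η * Measure.hausdorffMeasure 1 (Z ∩ I j) := by
          simpa using hlip.hausdorffMeasure_image_le zero_le_one
      _ ≤ η * Measure.hausdorffMeasure 1 (I j) := by gcongr; exact inter_subset_right
      _ = _ := by
          rw [hausdorffMeasure_real, Real.volume_Ico]
          congr 2
          ring
  calc Measure.hausdorffMeasure 1 (f '' Z)
      ≤ ∑ j ∈ Finset.range (k + 1), Measure.hausdorffMeasure 1 (f '' (Z ∩ I j)) :=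
        (measure_mono hsub).trans (measure_biUnion_finset_le _ _)
    _ ≤ ∑ _j ∈ Finset.range (k + 1), η * ENNReal.ofReal (1 / k) :=
        Finset.sum_le_sum fun j _ => hpiece j
    _ = η * (((k + 1 : ℕ) : ENNReal) * ENNReal.ofReal (1 / k)) := by
        rw [Finset.sum_const, Finset.card_range, nsmul_eq_mul]
        ring
    _ ≤ η * 2 := by
        gcongr
        rw [← ENNReal.ofReal_natCast, ← ENNReal.ofReal_mul (by positivity),
          ← ENNReal.ofReal_ofNat]
        refine ENNReal.ofReal_le_ofReal ?_
        rw [mul_one_div, div_le_iff₀ hk']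
        have : (1 : ℝ) ≤ k := by exact_mod_cast hk
        push_cast
        linarith
    _ = 2 * η := mul_comm _ _

variable {V : Type*} [NormedAddCommGroup V] [NormedSpace ℝ V]

theorem HasDerivAt.exists_norm_sub_le {f : ℝ → V} {v : V} {t : ℝ} (h : HasDerivAt f v t) {ε : ℝ}
    (hε : 0 < ε) :
    ∃ τ > 0, ∀ s, |s - t| < τ → ‖f s - f t - (s - t) • v‖ ≤ ε * |s - t| := by
  have h1 := (hasDerivAt_iff_isLittleO.1 h).def hε
  obtain ⟨τ, hτ, h2⟩ := Metric.eventually_nhds_iff.1 h1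
  exact ⟨τ, hτ, fun s hs => by simpa using h2 (by rwa [Real.dist_eq])⟩

variable [MeasurableSpace V] [BorelSpace V]

/-- A one-dimensional Sard theorem: the critical values of a curve have length zero. -/
theorem hausdorffMeasure_image_critical_eq_zero (f : ℝ → V) :
    Measure.hausdorffMeasure 1 (f '' {t ∈ Icc (0 : ℝ) 1 | HasDerivAt f 0 t}) = 0 := by
  have key : ∀ η : ℝ≥0, 0 < η →
      Measure.hausdorffMeasure 1 (f '' {t ∈ Icc (0 : ℝ) 1 | HasDerivAt f 0 t}) ≤ 2 * η := by
    intro η hη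
    let Z : ℕ → Set ℝ := fun n => {t ∈ Icc (0 : ℝ) 1 |
      ∀ s, |s - t| < 1 / ((n + 1 : ℕ) : ℝ) → dist (f s) (f t) ≤ η * |s - t|}
    have hmono : Monotone fun n => f '' Z n := by
      intro m n hmn
      refine image_mono fun t ht => ⟨ht.1, fun s hs => ht.2 s (hs.trans_le ?_)⟩
      gcongr
    have hsub : f '' {t ∈ Icc (0 : ℝ) 1 | HasDerivAt f 0 t} ⊆ ⋃ n, f '' Z n := by
      rintro _ ⟨t, ⟨ht, hder⟩, rfl⟩
      obtain ⟨τ, hτ, h⟩ := hder.exists_norm_sub_le (NNReal.coe_pos.2 hη)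
      obtain ⟨n, hn⟩ := exists_nat_one_div_lt hτ
      refine mem_iUnion.2 ⟨n, t, ⟨ht, fun s hs => ?_⟩, rfl⟩
      rw [dist_eq_norm]
      simpa using h s (hs.trans (by exact_mod_cast hn))
    refine (measure_mono hsub).trans ?_
    rw [hmono.measure_iUnion]
    exact iSup_le fun n => hausdorffMeasure_image_le_of_small_scale n.succ_pos
  refine le_antisymm (ENNReal.le_of_forall_pos_le_add fun ε hε _ => ?_) zero_le
  refine (key (ε / 2) (by positivity)).trans ?_
  rw [zero_add, ← ENNReal.coe_ofNat, ← ENNReal.coe_mul, mul_div_cancel₀ ε two_ne_zero]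

/-- Almost every point of a Lipschitz curve is the image of a parameter with nonzero derivative. -/
theorem ae_exists_hasDerivAt_ne_zero [FiniteDimensional ℝ V] {f : ℝ → V} {C : ℝ≥0}
    (hf : LipschitzWith C f) :
    ∀ᵐ x ∂((Measure.hausdorffMeasure 1 : Measure V).restrict (f '' Icc 0 1)),
      ∃ t, f t = x ∧ ∃ v ≠ 0, HasDerivAt f v t := by
  have hN : Measure.hausdorffMeasure 1 (f '' {t | ¬ DifferentiableAt ℝ f t}) = 0 := by
    have h1 := hf.hausdorffMeasure_image_le zero_le_one {t | ¬ DifferentiableAt ℝ f t}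
    have h2 : volume {t | ¬ DifferentiableAt ℝ f t} = 0 := hf.ae_differentiableAt (μ := volume)
    rw [hausdorffMeasure_real, h2, mul_zero] at h1
    exact le_antisymm h1 zero_le
  have hmeas : MeasurableSet (f '' Icc 0 1) :=
    (isCompact_Icc.image hf.continuous).measurableSet
  rw [ae_restrict_iff' hmeas]
  refine measure_mono_null ?_
    (measure_union_null hN (hausdorffMeasure_image_critical_eq_zero f))
  intro x hx
  simp only [mem_compl_iff, mem_ofPred_eq, Classical.not_imp, not_exists, not_and] at hx
  obtain ⟨⟨t, ht, rfl⟩, hx⟩ := hx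
  by_cases hd : DifferentiableAt ℝ f t
  · refine Or.inr ⟨t, ⟨ht, ?_⟩, rfl⟩
    by_contra h
    refine hx t rfl (deriv f t) (fun h0 => h ?_) hd.hasDerivAt
    rw [← h0]
    exact hd.hasDerivAt
  · exact Or.inl ⟨t, hd, rfl⟩

end Derivative

/-! ### Tangent lines at points of differentiability -/

section Tangent

/-- A differentiable curve in `K` gives a tangent line to `K` provided that near the point `K` stays
close to every short subarc of the curve. -/
theorem isTangentLine_of_hasDerivAt {K : Set Plane} {f : ℝ → Plane} (hf : Continuous f)
    (hfK : ∀ t, f t ∈ K) {t : ℝ} {v : Plane} (hv : v ≠ 0) (hder : HasDerivAt f v t)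
    (hclose : ∀ p q : ℚ, (p : ℝ) < t → t < q → ∀ ε > 0, ∃ ρ > 0, ∀ y ∈ K, dist y (f t) < ρ →
      Metric.infDist y (f '' Icc (p : ℝ) q) ≤ ε * dist y (f t)) :
    IsTangentLine K (f t) (AffineSubspace.mk' (f t) (ℝ ∙ v)) := by
  have hv' : 0 < ‖v‖ := norm_pos_iff.2 hv
  refine ⟨AffineSubspace.self_mem_mk' _ _, ?_, ?_⟩
  · rw [AffineSubspace.direction_mk']
    exact finrank_span_singleton hv
  have hmem : ∀ c : ℝ, f t + c • v ∈ (AffineSubspace.mk' (f t) (ℝ ∙ v) : Set Plane) := fun c => by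
    rw [SetLike.mem_coe, AffineSubspace.mem_mk', vsub_eq_sub, add_sub_cancel_left]
    exact Submodule.mem_span_singleton.2 ⟨c, rfl⟩
  -- It suffices to bound the distance by `8 * ε * r` at all small scales `r`.
  suffices H : ∀ ε : ℝ, 0 < ε → ε ≤ 1 / 2 → ∃ r₀ > 0, ∀ r : ℝ, 0 < r → r < r₀ →
      Metric.hausdorffDist (K ∩ Metric.ball (f t) r)
        ((AffineSubspace.mk' (f t) (ℝ ∙ v) : Set Plane) ∩ Metric.ball (f t) r) ≤ 8 * ε * r by
    rw [Metric.tendsto_nhds]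
    intro η hη
    obtain ⟨r₀, hr₀, h⟩ := H (min (1 / 2) (η / 16)) (by positivity) (min_le_left _ _)
    filter_upwards [Ioo_mem_nhdsGT hr₀] with r hr
    rw [Real.dist_eq, sub_zero, abs_of_nonneg (div_nonneg Metric.hausdorffDist_nonneg hr.1.le),
      div_lt_iff₀ hr.1]
    refine (h r hr.1 hr.2).trans_lt ?_
    have := min_le_right (1 / 2) (η / 16)
    have h2 := mul_le_mul_of_nonneg_right this hr.1.le
    have h3 := mul_pos hη hr.1
    linarith
  intro ε hε hε2
  obtain ⟨τ, hτ, hτf⟩ := hder.exists_norm_sub_le (mul_pos hε hv')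
  obtain ⟨p, hp1, hp2⟩ := exists_rat_btwn (show t - τ < t by linarith)
  obtain ⟨q, hq1, hq2⟩ := exists_rat_btwn (show t < t + τ by linarith)
  obtain ⟨ρ, hρ, hρK⟩ := hclose p q hp2 hq1 ε hε
  refine ⟨min ρ (τ * ‖v‖), by positivity, fun r hr hr₀ => ?_⟩
  have hrρ := hr₀.trans_le (min_le_left _ _)
  have hrτ := hr₀.trans_le (min_le_right _ _)
  refine Metric.hausdorffDist_le_of_mem_dist (by positivity) ?_ ?_
  · rintro y ⟨hyK, hyr⟩
    rw [Metric.mem_ball] at hyr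
    have hEc : IsCompact (f '' Icc (p : ℝ) q) := isCompact_Icc.image hf
    obtain ⟨_, ⟨s, hs, rfl⟩, hys⟩ := hEc.exists_infDist_eq_dist
      ((nonempty_Icc.2 (hp2.trans hq1).le).image f) y
    have h1 : dist y (f s) ≤ ε * dist y (f t) := hys ▸ hρK y hyK (hyr.trans hrρ)
    have h2 := hτf s (abs_lt.2 ⟨by linarith [hs.1], by linarith [hs.2]⟩)
    set d := dist y (f t) with hd
    have hd0 : 0 ≤ d := dist_nonneg
    set m := |s - t| * ‖v‖ with hm
    have hsv : ‖(s - t) • v‖ = m := by rw [norm_smul, Real.norm_eq_abs]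
    have h2' : ‖f s - f t - (s - t) • v‖ ≤ ε * m := by
      rw [hm]
      linarith
    have h3 : m ≤ ‖f s - f t‖ + ε * m := by
      have := norm_sub_norm_le ((s - t) • v) (f s - f t)
      rw [hsv, norm_sub_rev ((s - t) • v)] at this
      linarith
    have h4 : ‖f s - f t‖ ≤ (1 + ε) * d := by
      rw [← dist_eq_norm]
      linarith [dist_triangle_left (f s) (f t) y]
    have hm0 : 0 ≤ m := by positivity
    have h5 : m ≤ 3 * d := by nlinarith
    -- The point of the line is shrunk towards `f t` so that it lies in the ball.
    set c := (1 + 4 * ε)⁻¹ with hc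
    have hc0 : 0 < c := by positivity
    have hc1 : c * (1 + 4 * ε) = 1 := inv_mul_cancel₀ (by positivity)
    have hyw : dist y (f t + (s - t) • v) ≤ 4 * ε * d := by
      have h6 : dist (f s) (f t + (s - t) • v) ≤ ε * m := by
        rwa [dist_eq_norm, ← sub_sub]
      have h7 := mul_le_mul_of_nonneg_left h5 hε.le
      linarith [dist_triangle y (f s) (f t + (s - t) • v)]
    have hmd : m ≤ (1 + 4 * ε) * d := by
      have h8 : dist (f t + (s - t) • v) (f t) = m := by
        rw [dist_eq_norm, add_sub_cancel_left, hsv]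
      linarith [dist_triangle_left (f t + (s - t) • v) (f t) y]
    have hcm : c * m ≤ d := by
      calc c * m ≤ c * ((1 + 4 * ε) * d) := by gcongr
        _ = d := by rw [← mul_assoc, hc1, one_mul]
    refine ⟨f t + (c * (s - t)) • v, ⟨hmem _, ?_⟩, ?_⟩
    · rw [Metric.mem_ball, dist_eq_norm, add_sub_cancel_left, mul_smul, norm_smul, hsv,
        Real.norm_eq_abs, abs_of_pos hc0]
      exact hcm.trans_lt hyr
    · have hc2 : c ≤ 1 := by nlinarith
      have h9 : dist (f t + (s - t) • v) (f t + (c * (s - t)) • v) = (1 - c) * m := by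
        rw [dist_eq_norm, add_sub_add_left_eq_sub, ← sub_smul,
          show s - t - c * (s - t) = (1 - c) * (s - t) by ring, mul_smul, norm_smul, hsv,
          Real.norm_eq_abs, abs_of_nonneg (sub_nonneg.2 hc2)]
      have h10 : (1 - c) * m ≤ 4 * ε * d := by
        calc (1 - c) * m ≤ (1 - c) * ((1 + 4 * ε) * d) :=
              mul_le_mul_of_nonneg_left hmd (sub_nonneg.2 hc2)
          _ = (1 + 4 * ε - c * (1 + 4 * ε)) * d := by ring
          _ = 4 * ε * d := by rw [hc1]; ring
      have h11 := mul_le_mul_of_nonneg_left hyr.le hε.le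
      linarith [dist_triangle y (f t + (s - t) • v) (f t + (c * (s - t)) • v)]
  · rintro z ⟨hzT, hzr⟩
    rw [SetLike.mem_coe, AffineSubspace.mem_mk', vsub_eq_sub] at hzT
    obtain ⟨c, hc⟩ := Submodule.mem_span_singleton.1 hzT
    rw [Metric.mem_ball, dist_eq_norm, ← hc, norm_smul, Real.norm_eq_abs] at hzr
    have hcτ : |c| < τ := by
      have := hzr.trans hrτ
      exact lt_of_mul_lt_mul_right this hv'.le
    have hz : z = f t + c • v := by rw [hc]; abel
    have hε1 : 0 ≤ 1 - ε := by linarith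
    -- The parameter is shrunk by `1 - ε` so that the point of the curve lies in the ball.
    have habs : |t + (1 - ε) * c - t| = (1 - ε) * |c| := by
      rw [add_sub_cancel_left, abs_mul, abs_of_nonneg hε1]
    have h1 := hτf (t + (1 - ε) * c) (by rw [habs]; nlinarith [abs_nonneg c])
    rw [habs, add_sub_cancel_left] at h1
    have hm0 : 0 ≤ |c| * ‖v‖ := by positivity
    have h2 : ‖((1 - ε) * c) • v‖ = (1 - ε) * (|c| * ‖v‖) := by
      rw [norm_smul, Real.norm_eq_abs, abs_mul, abs_of_nonneg hε1, mul_assoc]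
    have h3 : ε * ‖v‖ * ((1 - ε) * |c|) = ε * (1 - ε) * (|c| * ‖v‖) := by ring
    rw [h3] at h1
    refine ⟨f (t + (1 - ε) * c), ⟨hfK _, ?_⟩, ?_⟩
    · rw [Metric.mem_ball, dist_eq_norm]
      have := norm_le_norm_add_norm_sub' (f (t + (1 - ε) * c) - f t) (((1 - ε) * c) • v)
      rw [h2] at this
      nlinarith [mul_nonneg (sq_nonneg ε) hm0]
    · have h4 : ‖(ε * c) • v‖ = ε * (|c| * ‖v‖) := by
        rw [norm_smul, Real.norm_eq_abs, abs_mul, abs_of_pos hε, mul_assoc]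
      have h5 : z - f (t + (1 - ε) * c) =
          (ε * c) • v - (f (t + (1 - ε) * c) - f t - ((1 - ε) * c) • v) := by
        rw [hz, show (ε * c) = c - (1 - ε) * c by ring, sub_smul]
        abel
      rw [dist_eq_norm, h5]
      refine (norm_sub_le _ _).trans ?_
      rw [h4]
      have h6 := mul_le_mul_of_nonneg_left hzr.le hε.le
      have h7 := mul_nonneg (mul_nonneg hε.le hε.le) hm0
      have h8 := mul_nonneg hε.le hm0
      nlinarith

end Tangent

/-! ### Projection onto a tangent line -/

section Projection

/-- Along a half-line `x + s • v`, a connected set `K` that lies in a cone around the line and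
approximates each of its points to relative accuracy `1 / 8` has no small gaps: two gaps would cut
off a nonempty relatively clopen part of `K` between them. -/
theorem exists_forall_pos_exists_inner_eq {V : Type*} [NormedAddCommGroup V]
    [InnerProductSpace ℝ V] {K : Set V} (hK : IsPreconnected K) {x v : V} (hx : x ∈ K)
    (hv : ‖v‖ = 1) {R : ℝ} (hR : 0 < R)
    (hcone : ∀ y ∈ K, dist y x < R → dist y x ≤ 2 * |inner ℝ v (y - x)|)
    (happrox : ∀ s, 0 < s → s < R → ∃ y ∈ K, dist y (x + s • v) ≤ s / 8) :
    ∃ ρ > 0, ∀ s, 0 < s → s < ρ → ∃ y ∈ K, dist y x < R ∧ inner ℝ v (y - x) = s := by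
  by_cases hgap : ∃ s₀, 0 < s₀ ∧ s₀ < R / 4 ∧ ∀ y ∈ K, dist y x < R → inner ℝ v (y - x) ≠ s₀
  swap
  · push Not at hgap
    exact ⟨R / 4, by positivity, hgap⟩
  obtain ⟨s₀, hs₀, hs₀R, hs₀K⟩ := hgap
  refine ⟨s₀ / 4, by positivity, fun s hs hss₀ => ?_⟩
  by_contra! hsK
  have hφ : Continuous fun y => inner ℝ v (y - x) := by fun_prop
  -- The part of `K` strictly between the gaps `s` and `s₀`, as an open and as a closed condition:
  -- the cone condition replaces the open ball of radius `R` by the closed one of radius `R / 2`.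
  let U : Set V := Metric.ball x R ∩ {y | s < inner ℝ v (y - x)} ∩ {y | inner ℝ v (y - x) < s₀}
  let W : Set V := Metric.closedBall x (R / 2) ∩ {y | s ≤ inner ℝ v (y - x)} ∩
    {y | inner ℝ v (y - x) ≤ s₀}
  have hU : IsOpen U := (Metric.isOpen_ball.inter (isOpen_lt continuous_const hφ)).inter
    (isOpen_lt hφ continuous_const)
  have hW : IsClosed W := (Metric.isClosed_closedBall.inter (isClosed_le continuous_const hφ)).inter
    (isClosed_le hφ continuous_const)
  have hUW : ∀ y ∈ K, y ∈ U → y ∈ W := by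
    rintro y hy ⟨⟨hyR, hsy⟩, hys⟩
    have hsy : s < inner ℝ v (y - x) := hsy
    have hys : inner ℝ v (y - x) < s₀ := hys
    have := hcone y hy hyR
    rw [abs_of_pos (hs.trans hsy)] at this
    exact ⟨⟨Metric.mem_closedBall.2 (by linarith), hsy.le⟩, hys.le⟩
  have hWU : ∀ y ∈ K, y ∈ W → y ∈ U := by
    rintro y hy ⟨⟨hyR, hsy⟩, hys⟩
    have hyR' : dist y x < R := (Metric.mem_closedBall.1 hyR).trans_lt (by linarith)
    exact ⟨⟨hyR', lt_of_le_of_ne hsy (hsK y hy hyR').symm⟩, lt_of_le_of_ne hys (hs₀K y hy hyR')⟩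
  have hKU : (K ∩ U).Nonempty := by
    obtain ⟨y, hy, hyd⟩ := happrox (s₀ / 2) (by positivity) (by linarith)
    have h1 : |inner ℝ v (y - x) - s₀ / 2| ≤ s₀ / 2 / 8 := by
      have h2 : inner ℝ v (y - x) - s₀ / 2 = inner ℝ v (y - (x + (s₀ / 2) • v)) := by
        rw [← sub_sub, inner_sub_right v (y - x), inner_smul_right, real_inner_self_eq_norm_sq, hv]
        ring
      rw [h2]
      refine (abs_real_inner_le_norm _ _).trans ?_
      rwa [hv, one_mul, ← dist_eq_norm]
    have h3 : dist (x + (s₀ / 2) • v) x = s₀ / 2 := by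
      rw [dist_eq_norm, add_sub_cancel_left, norm_smul, hv, mul_one, Real.norm_eq_abs,
        abs_of_pos (by positivity)]
    rw [abs_le] at h1
    refine ⟨y, hy, ⟨Metric.mem_ball.2 ?_, ?_⟩, ?_⟩
    · linarith [dist_triangle y (x + (s₀ / 2) • v) x]
    · simp only [mem_ofPred_eq]
      linarith
    · simp only [mem_ofPred_eq]
      linarith
  have hxW : x ∉ W := by
    rintro ⟨⟨-, h⟩, -⟩
    simp only [mem_ofPred_eq, sub_self, inner_zero_right] at h
    linarith
  obtain ⟨y, hy, hyU, hyW⟩ := hK U Wᶜ hU hW.isOpen_compl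
    (fun y hy => (em (y ∈ W)).imp (hWU y hy) id) hKU ⟨x, hx, hxW⟩
  exact hyW (hUW y hy hyU)

/-- The two halves of the tangency condition in the coordinate `inner ℝ v (y - x)` along the line:
`K` lies in a cone around the line, and each point of the line is close to `K`. -/
theorem IsTangentLine.exists_cone_and_approx {K : Set Plane} {x : Plane}
    {T : AffineSubspace ℝ Plane} (hT : IsTangentLine K x T) (hx : x ∈ K) {v : Plane}
    (hv : ‖v‖ = 1) (hmem : ∀ y, y ∈ T ↔ ∃ c : ℝ, y = x + c • v) {δ : ℝ} (hδ : 0 < δ) :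
    ∃ R > 0, (∀ y ∈ K, dist y x < R →
        (1 - 2 * δ) * dist y x ≤ |inner ℝ v (y - x)|) ∧
      ∀ s : ℝ, s ≠ 0 → |s| < R → ∃ y ∈ K, dist y (x + s • v) ≤ δ * |s| := by
  have hev := (Metric.tendsto_nhds.1 hT.2.2) (δ / 2) (by positivity)
  obtain ⟨r₀, hr₀, hsub⟩ := mem_nhdsGT_iff_exists_Ioo_subset.1 hev
  have hr₀ : 0 < r₀ := hr₀
  have hdist : ∀ r, 0 < r → r < r₀ → Metric.hausdorffDist (K ∩ Metric.ball x r)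
      ((T : Set Plane) ∩ Metric.ball x r) < δ / 2 * r := by
    intro r hr hrr
    have := hsub ⟨hr, hrr⟩
    rw [mem_ofPred_eq, Real.dist_eq, sub_zero,
      abs_of_nonneg (div_nonneg Metric.hausdorffDist_nonneg hr.le), div_lt_iff₀ hr] at this
    exact this
  have hfin : ∀ r, 0 < r → Metric.hausdorffEDist (K ∩ Metric.ball x r)
      ((T : Set Plane) ∩ Metric.ball x r) ≠ ⊤ := fun r hr =>
    Metric.hausdorffEDist_ne_top_of_nonempty_of_bounded ⟨x, hx, Metric.mem_ball_self hr⟩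
      ⟨x, hT.1, Metric.mem_ball_self hr⟩ (Metric.isBounded_ball.subset inter_subset_right)
      (Metric.isBounded_ball.subset inter_subset_right)
  have hnorm : ∀ c : ℝ, dist (x + c • v) x = |c| := fun c => by
    rw [dist_eq_norm, add_sub_cancel_left, norm_smul, hv, mul_one, Real.norm_eq_abs]
  refine ⟨r₀ / 2, by positivity, fun y hy hyR => ?_, fun s hs hsR => ?_⟩
  · rcases (dist_nonneg : 0 ≤ dist y x).eq_or_lt with h0 | h0
    · rw [← h0, mul_zero]
      exact abs_nonneg _
    obtain ⟨z, ⟨hzT, -⟩, hyz⟩ := Metric.exists_dist_lt_of_hausdorffDist_lt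
      (mem_inter hy (Metric.mem_ball.2 (show dist y x < 2 * dist y x by linarith)))
      (hdist (2 * dist y x) (by positivity) (by linarith)) (hfin _ (by positivity))
    obtain ⟨c, rfl⟩ := (hmem z).1 hzT
    have h1 : |inner ℝ v (y - x) - c| ≤ dist y (x + c • v) := by
      have h2 : inner ℝ v (y - x) - c = inner ℝ v (y - (x + c • v)) := by
        rw [← sub_sub, inner_sub_right v (y - x), inner_smul_right, real_inner_self_eq_norm_sq, hv]
        ring
      rw [h2, dist_eq_norm]
      simpa [hv] using abs_real_inner_le_norm v (y - (x + c • v))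
    have h3 := dist_triangle y (x + c • v) x
    rw [hnorm] at h3
    have h4 := abs_sub_abs_le_abs_sub c (inner ℝ v (y - x))
    rw [abs_sub_comm] at h4
    linarith
  · have hs' : 0 < |s| := abs_pos.2 hs
    obtain ⟨y, ⟨hy, -⟩, hyz⟩ := Metric.exists_dist_lt_of_hausdorffDist_lt'
      (mem_inter ((hmem _).2 ⟨s, rfl⟩) (Metric.mem_ball.2
        (show dist (x + s • v) x < 2 * |s| by rw [hnorm]; linarith)))
      (hdist (2 * |s|) (by positivity) (by linarith)) (hfin _ (by positivity))
    exact ⟨y, hy, by linarith⟩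

theorem exists_unit_direction {V : Type*} [NormedAddCommGroup V] [InnerProductSpace ℝ V]
    {T : AffineSubspace ℝ V} {x : V} (hx : x ∈ T) (hT : Module.finrank ℝ T.direction = 1) :
    ∃ v : V, ‖v‖ = 1 ∧ T.direction = ℝ ∙ v ∧ ∀ y, y ∈ T ↔ ∃ c : ℝ, y = x + c • v := by
  obtain ⟨⟨w, hwT⟩, hw0, hw⟩ := finrank_eq_one_iff'.1 hT
  have hw0' : w ≠ 0 := fun h => hw0 (Subtype.ext h)
  have hdir : T.direction = ℝ ∙ w := by
    refine le_antisymm (fun u hu => ?_) ?_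
    · obtain ⟨c, hc⟩ := hw ⟨u, hu⟩
      exact Submodule.mem_span_singleton.2 ⟨c, congrArg Subtype.val hc⟩
    · rwa [Submodule.span_singleton_le_iff_mem]
  have hn : ‖w‖⁻¹ ≠ 0 := inv_ne_zero (norm_ne_zero_iff.2 hw0')
  have hdir' : T.direction = ℝ ∙ (‖w‖⁻¹ • w) := by
    rw [hdir, Submodule.span_singleton_smul_eq (IsUnit.mk0 _ hn)]
  refine ⟨‖w‖⁻¹ • w, norm_smul_inv_norm hw0', hdir', fun y => ?_⟩
  rw [← AffineSubspace.vsub_right_mem_direction_iff_mem hx, hdir', Submodule.mem_span_singleton,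
    vsub_eq_sub]
  exact exists_congr fun c => by rw [eq_sub_iff_add_eq, eq_comm, add_comm]

/-- The projection onto a tangent line covers the line near the point: gaps at small scales are
excluded on each of the two half-lines, and the cone condition keeps the preimages in the ball. -/
theorem exists_subset_image_orthogonalProjection {K : Set Plane} (hK : IsPreconnected K)
    {x : Plane} (hx : x ∈ K) {T : AffineSubspace ℝ Plane} [Nonempty T] (hT : IsTangentLine K x T)
    {ε : ℝ} (hε : 0 < ε) (hε2 : ε < 1 / 2) :
    ∃ r₀ > (0 : ℝ), ∀ r : ℝ, 0 < r → r ≤ r₀ →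
      (T : Set Plane) ∩ Metric.ball x ((1 - ε) * r) ⊆
        (fun y : Plane => (EuclideanGeometry.orthogonalProjection T y : Plane)) ''
          (K ∩ Metric.ball x r) := by
  obtain ⟨v, hv, hdir, hmem⟩ := exists_unit_direction hT.1 hT.2.1
  obtain ⟨R, hR, hcone, happrox⟩ := hT.exists_cone_and_approx hx hv hmem
    (δ := ε / 4) (by positivity)
  have hcone' : ∀ y ∈ K, dist y x < R → dist y x ≤ 2 * |inner ℝ v (y - x)| := fun y hy hyR => by
    have := hcone y hy hyR
    nlinarith [dist_nonneg (x := y) (y := x)]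
  obtain ⟨ρ₁, hρ₁, h₁⟩ := exists_forall_pos_exists_inner_eq hK hx hv hR hcone' fun s hs hsR => by
    obtain ⟨y, hy, hys⟩ := happrox s hs.ne' (by rwa [abs_of_pos hs])
    rw [abs_of_pos hs] at hys
    exact ⟨y, hy, by nlinarith⟩
  obtain ⟨ρ₂, hρ₂, h₂⟩ := exists_forall_pos_exists_inner_eq hK hx (v := -v) (by rwa [norm_neg]) hR
    (fun y hy hyR => by
      rw [inner_neg_left, abs_neg]
      exact hcone' y hy hyR) fun s hs hsR => by
    obtain ⟨y, hy, hys⟩ := happrox (-s) (by linarith) (by rwa [abs_neg, abs_of_pos hs])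
    rw [abs_neg, abs_of_pos hs] at hys
    refine ⟨y, hy, ?_⟩
    rw [smul_neg, ← neg_smul]
    nlinarith
  have hall : ∀ s : ℝ, |s| < min ρ₁ ρ₂ → ∃ y ∈ K, dist y x < R ∧ inner ℝ v (y - x) = s := by
    intro s hs
    rcases lt_trichotomy s 0 with h | rfl | h
    · rw [abs_of_neg h] at hs
      obtain ⟨y, hy, hyR, hys⟩ := h₂ (-s) (by linarith) (hs.trans_le (min_le_right _ _))
      rw [inner_neg_left, neg_inj] at hys
      exact ⟨y, hy, hyR, hys⟩
    · exact ⟨x, hx, by simpa using hR, by simp⟩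
    · rw [abs_of_pos h] at hs
      exact h₁ s h (hs.trans_le (min_le_left _ _))
  refine ⟨min ρ₁ ρ₂, by positivity, fun r hr hrρ => ?_⟩
  rintro z ⟨hzT, hzr⟩
  obtain ⟨s, rfl⟩ := (hmem z).1 hzT
  rw [Metric.mem_ball, dist_eq_norm, add_sub_cancel_left, norm_smul, hv, mul_one,
    Real.norm_eq_abs] at hzr
  obtain ⟨y, hy, hyR, hys⟩ := hall s (by nlinarith)
  refine ⟨y, ⟨hy, Metric.mem_ball.2 ?_⟩, ?_⟩
  · have := hcone y hy hyR
    rw [hys] at this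
    nlinarith
  · refine EuclideanGeometry.coe_orthogonalProjection_eq_iff_mem.2 ⟨hzT, ?_⟩
    rw [hdir, Submodule.mem_orthogonal_singleton_iff_inner_right, vsub_eq_sub, ← sub_sub,
      inner_sub_right, inner_smul_right, real_inner_self_eq_norm_sq, hv, hys]
    ring

end Projection

/-! ### Continua of finite length -/

section Continuum

theorem exists_lipschitzOnWith_image_Icc_eq {X : Type*} [MetricSpace X] [MeasurableSpace X]
    [BorelSpace X] {K : Set X} (hKc : IsCompact K) (hK : IsConnected K)
    (hfin : Measure.hausdorffMeasure 1 K < ⊤) :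
    ∃ (f : ℝ → X) (C : ℝ≥0),
      LipschitzOnWith C f (Icc 0 (Measure.hausdorffMeasure 1 K).toReal) ∧
        f '' Icc 0 (Measure.hausdorffMeasure 1 K).toReal = K := by
  obtain ⟨x, hx⟩ := hK.nonempty
  rcases K.subsingleton_or_nontrivial with hs | hnt
  · refine ⟨fun _ => x, 0, LipschitzWith.const x |>.lipschitzOnWith, ?_⟩
    rw [(nonempty_Icc.2 ENNReal.toReal_nonneg).image_const, ← hs.eq_singleton_of_mem hx]
  · obtain ⟨f, C, hf, -, hfs⟩ := exists_lipschitz_parametrization hKc hK.isPreconnected hfin hnt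
    obtain ⟨a, ha, b, hb, hab⟩ := hnt
    set L := (Measure.hausdorffMeasure 1 K).toReal with hLdef
    have hL : 0 < L := by
      refine ENNReal.toReal_pos (fun h0 => ?_) hfin.ne
      have h1 := (ofReal_le_hausdorffMeasure_inter_ball hK.isPreconnected ha hb le_rfl).trans
        (measure_mono inter_subset_left)
      rw [h0, nonpos_iff_eq_zero, ENNReal.ofReal_eq_zero] at h1
      exact absurd h1 (not_le.2 (dist_pos.2 hab.symm))
    refine ⟨fun s => f (s / L), C * L.toNNReal⁻¹, LipschitzWith.lipschitzOnWith
      (LipschitzWith.of_dist_le_mul fun s t => (hf.dist_le_mul _ _).trans_eq ?_), ?_⟩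
    · rw [Real.dist_eq, Real.dist_eq, ← sub_div, abs_div, abs_of_pos hL, NNReal.coe_mul,
        NNReal.coe_inv, Real.coe_toNNReal _ hL.le]
      ring
    · refine Eq.trans (Subset.antisymm ?_ ?_) hfs
      · rintro _ ⟨s, hs, rfl⟩
        exact ⟨s / L, ⟨div_nonneg hs.1 hL.le, (div_le_one hL).2 hs.2⟩, rfl⟩
      · rintro _ ⟨t, ht, rfl⟩
        exact ⟨t * L, ⟨mul_nonneg ht.1 hL.le, mul_le_of_le_one_left hL.le ht.2⟩,
          by simp only [mul_div_cancel_right₀ t hL.ne']⟩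

/-- The tangent at `f t` is spanned by `f' t`, for any parameter `t` with `f' t ≠ 0`: different
choices of `t` need not be compared, since almost surely each short subarc through the point is
non-porous in `K` there, and no injectivity of `f` is needed. -/
theorem ae_exists_isTangentLine {K : Set Plane} (hKc : IsCompact K) (hK : IsPreconnected K)
    (hfin : Measure.hausdorffMeasure 1 K < ⊤) :
    ∀ᵐ x ∂((Measure.hausdorffMeasure 1 : Measure Plane).restrict K),
      ∃ T : AffineSubspace ℝ Plane, IsTangentLine K x T := by
  rcases K.subsingleton_or_nontrivial with hs | hnt
  · have := Measure.nullSingletonClass_hausdorff Plane one_pos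
    rw [Measure.restrict_eq_zero.2 (hs.measure_zero _)]
    simp
  obtain ⟨f, C, hf, hfK, hfs⟩ := exists_lipschitz_parametrization hKc hK hfin hnt
  -- Countably many subarcs and accuracies suffice to exclude porosity with one null set.
  have hpor : ∀ᵐ x ∂((Measure.hausdorffMeasure 1 : Measure Plane).restrict K),
      ∀ (p q : ℚ) (n : ℕ), x ∈ f '' Icc (p : ℝ) q → ∃ ρ > 0, ∀ y ∈ K, dist y x < ρ →
        Metric.infDist y (f '' Icc (p : ℝ) q) ≤ 1 / ((n : ℝ) + 1) * dist y x := by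
    refine ae_all_iff.2 fun p => ae_all_iff.2 fun q => ae_all_iff.2 fun n =>
      ae_restrict_of_ae (measure_mono_null ?_ (hausdorffMeasure_porous_eq_zero hKc hK hfin hnt
        (isCompact_Icc.image hf.continuous).isClosed (E := f '' Icc (p : ℝ) q)
        (ε := 1 / ((n : ℝ) + 1)) (by positivity) ?_))
    · intro x hx
      simp only [mem_compl_iff, mem_ofPred_eq, Classical.not_imp] at hx
      refine ⟨hx.1, ?_⟩
      have := hx.2
      push Not at this
      exact this
    · rw [div_le_one (by positivity)]
      linarith [(Nat.cast_nonneg n : (0 : ℝ) ≤ n)]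
  have hder := ae_exists_hasDerivAt_ne_zero hf
  rw [hfs] at hder
  filter_upwards [hpor, hder] with x hx ⟨t, htx, v, hv, hd⟩
  subst htx
  refine ⟨_, isTangentLine_of_hasDerivAt hf.continuous hfK hv hd fun p q hp hq ε hε => ?_⟩
  obtain ⟨n, hn⟩ := exists_nat_one_div_lt hε
  obtain ⟨ρ, hρ, h⟩ := hx p q n ⟨t, ⟨hp.le, hq.le⟩, rfl⟩
  exact ⟨ρ, hρ, fun y hy hyρ => (h y hy hyρ).trans (by gcongr)⟩

theorem isArcwiseConnected_of_hausdorffMeasure_lt_top {K : Set Plane} (hKc : IsCompact K)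
    (hK : IsConnected K) (hfin : Measure.hausdorffMeasure 1 K < ⊤) : IsArcwiseConnected K := by
  refine ⟨hK.nonempty, fun x hx y hy hxy => ?_⟩
  obtain ⟨f, C, hf, hfK, hfs⟩ :=
    exists_lipschitz_parametrization hKc hK.isPreconnected hfin ⟨x, hx, y, hy, hxy⟩
  exact exists_injective_path hKc hf hfK hfs hx hy hxy

end Continuum

theorem mainTheorem9 (K : Set Plane) (hKc : IsCompact K) (hKconn : IsConnected K)
    (hKfin : Measure.hausdorffMeasure 1 K < ⊤) :
    (∃ (f : ℝ → Plane) (C : ℝ≥0),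
      LipschitzOnWith C f (Set.Icc 0 (Measure.hausdorffMeasure 1 K).toReal) ∧
        f '' Set.Icc 0 (Measure.hausdorffMeasure 1 K).toReal = K) ∧
    IsArcwiseConnected K ∧
    (∀ᵐ x ∂((Measure.hausdorffMeasure 1 : Measure Plane).restrict K),
      ∃ T : AffineSubspace ℝ Plane, IsTangentLine K x T) ∧
    (∀ x ∈ K, ∀ (T : AffineSubspace ℝ Plane) [Nonempty T], IsTangentLine K x T →
      ∀ ε ∈ Set.Ioo (0 : ℝ) (1 / 2), ∃ r₀ > (0 : ℝ), ∀ r : ℝ, 0 < r → r ≤ r₀ →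
        (T : Set Plane) ∩ Metric.ball x ((1 - ε) * r) ⊆
          (fun y : Plane => (EuclideanGeometry.orthogonalProjection T y : Plane)) ''
            (K ∩ Metric.ball x r)) :=
  ⟨exists_lipschitzOnWith_image_Icc_eq hKc hKconn hKfin,
    isArcwiseConnected_of_hausdorffMeasure_lt_top hKc hKconn hKfin,
    ae_exists_isTangentLine hKc hKconn.isPreconnected hKfin,
    fun _ hx _ _ hT _ hε =>
      exists_subset_image_orthogonalProjection hKconn.isPreconnected hx hT hε.1 hε.2⟩
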